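/- Let $k$ be a field and let $m \ge n \ge 2$ be integers. Let $A_{n,m}$ be the graph obtained from two complete graphs $K_n$ and $K_m$ by letting them share exactly one vertex: its vertices are $x_1,\dots,x_n,y_2,\dots,y_m$, and its edges are all pairs inside $\{x_1,\dots,x_n\}$ and all pairs inside $\{x_n,y_2,\dots,y_m\}$. Let $R$ be the polynomial ring over $k$ whose variables are the vertices of $A_{n,m}$, let $\mathfrak m$ be the ideal generated by all the variables, and let $$I=\bigcap_{\{u,v\}\in E(A_{n,m})}(u,v)\subseteq R$$ be the cover ideal of $A_{n,m}$. Recall that a monomial ideal is \emph{quasi-equigenerated} if one can assign positive integer weights to the variables so that all its minimal monomial generators have the same weighted degree; that the \emph{analytic spread} $l(I)$ is the Krull dimension of the fiber cone $F(I)=\bigoplus_{i\ge0} I^i/\mathfrak m I^i$; and that a quasi-equigenerated monomial ideal $I$ is a \emph{Freiman ideal} if $\mu(I^2)=l(I)\,\mu(I)-\binom{l(I)}{2}$, where $\mu$ denotes the minimal number of generators of an ideal. Then $I$ is quasi-equigenerated, and: \begin{enumerate} \item the analytic spread of $I$ is $n+m-2$; \item $I$ is a Freiman ideal if and only if $n\le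 3$. \end{enumerate} -/

import Mathlib

open MvPolynomial

section

variable {k σ : Type*} [Field k]

/-- The minimal number of generators `μ(I)` of an ideal. -/
noncomputable def minGenerators (I : Ideal (MvPolynomial σ k)) : ℕ :=
  Submodule.spanFinrank I

/-- The fiber cone `F(I) = ⨁ I^i / 𝔪 I^i`, where `𝔪 = (x_1, …, x_n)` is the homogeneous maximal
ideal, as the quotient of the Rees algebra `R[It] = ⨁ I^i t^i` by the extension `𝔪 R[It]` of `𝔪`;
the latter is `⨁ 𝔪 I^i t^i`, see `mem_map_algebraMap_reesAlgebra_iff`. -/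
abbrev FiberCone (I : Ideal (MvPolynomial σ k)) : Type _ :=
  reesAlgebra I ⧸ (idealOfVars σ k).map (algebraMap (MvPolynomial σ k) (reesAlgebra I))

/-- The degree `i` component of the extension of an ideal `𝔪` to the Rees algebra of `I`
is `𝔪 I^i`. -/
theorem mem_map_algebraMap_reesAlgebra_iff {R : Type*} [CommRing R] (I 𝔪 : Ideal R)
    (f : reesAlgebra I) :
    f ∈ 𝔪.map (algebraMap R (reesAlgebra I)) ↔
      ∀ i, (f : Polynomial R).coeff i ∈ 𝔪 * I ^ i := by
  constructor
  · intro hf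
    refine Submodule.span_induction (p := fun (f : reesAlgebra I) _ =>
      ∀ i, (f : Polynomial R).coeff i ∈ 𝔪 * I ^ i) ?_ ?_ ?_ ?_ hf
    · rintro _ ⟨a, ha, rfl⟩ i
      change (algebraMap R (Polynomial R) a).coeff i ∈ _
      rw [Polynomial.algebraMap_apply, Polynomial.coeff_C]
      split_ifs with h
      · subst h; simpa using ha
      · exact zero_mem _
    · intro i; simp
    · intro x y _ _ hx hy i
      simpa using add_mem (hx i) (hy i)
    · intro a x _ hx i
      change ((a : Polynomial R) * (x : Polynomial R)).coeff i ∈ _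
      rw [Polynomial.coeff_mul]
      refine Ideal.sum_mem _ fun p hp => ?_
      rw [← Finset.HasAntidiagonal.mem_antidiagonal.mp hp, pow_add, mul_left_comm]
      exact Ideal.mul_mem_mul (a.2 p.1) (hx p.2)
  · intro hf
    have key : ∀ (i : ℕ) (r : R), r ∈ 𝔪 * I ^ i → Polynomial.monomial i r ∈
        Submodule.map ((reesAlgebra I).val.toLinearMap)
          ((𝔪.map (algebraMap R (reesAlgebra I))).restrictScalars R) := by
      intro i r hr
      refine Submodule.mul_induction_on hr ?_ ?_
      · intro a ha b hb
        refine ⟨algebraMap R (reesAlgebra I) a * ⟨_, reesAlgebra.monomial_mem.2 hb⟩,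
          Ideal.mul_mem_right _ _ (Ideal.mem_map_of_mem _ ha), ?_⟩
        change algebraMap R (Polynomial R) a * Polynomial.monomial i b = _
        rw [← Algebra.smul_def, Polynomial.smul_monomial, smul_eq_mul]
      · intro x y hx hy
        rw [map_add]
        exact add_mem hx hy
    have h : (f : Polynomial R) ∈ Submodule.map ((reesAlgebra I).val.toLinearMap)
          ((𝔪.map (algebraMap R (reesAlgebra I))).restrictScalars R) := by
      rw [(f : Polynomial R).as_sum_support]
      exact sum_mem fun i _ => key i _ (hf i)
    obtain ⟨g, hg, hgf⟩ := h
    obtain rfl : g = f := Subtype.ext hgf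
    exact hg

/-- The analytic spread `l(I)`: the Krull dimension of the fiber cone. -/
noncomputable def analyticSpread (I : Ideal (MvPolynomial σ k)) : WithBot ℕ∞ :=
  ringKrullDim (FiberCone I)

/-- `I` is a monomial ideal: it is generated by monomials. -/
def IsMonomialIdeal (I : Ideal (MvPolynomial σ k)) : Prop :=
  ∃ S : Set (σ →₀ ℕ), I = Ideal.span ((fun c => monomial c (1 : k)) '' S)

/-- The exponent vectors of the minimal monomial generators of `I`: those `c` for which `x^c`
is minimal with respect to divisibility among the monomials in `I`. -/
def minimalExponents (I : Ideal (MvPolynomial σ k)) : Set (σ →₀ ℕ) :=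
  {c | Minimal (fun e => monomial e (1 : k) ∈ I) c}

/-- A monomial ideal `I` is quasi-equigenerated if for some positive integer weights `α`
on the variables all its minimal monomial generators have the same weighted degree
`d_α(x^c) = ∑ α_i c_i`. -/
def IsQuasiEquigenerated (I : Ideal (MvPolynomial σ k)) : Prop :=
  IsMonomialIdeal I ∧ ∃ (α : σ → ℕ) (d : ℕ), (∀ i, 1 ≤ α i) ∧
    ∀ c ∈ minimalExponents I, (c.sum fun i e => α i * e) = d

/-- A quasi-equigenerated monomial ideal `I` is a Freiman ideal if
`μ(I^2) = l(I) μ(I) - binom(l(I), 2)`. -/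
def IsFreiman (I : Ideal (MvPolynomial σ k)) : Prop :=
  IsQuasiEquigenerated I ∧ ∃ l : ℕ, analyticSpread I = l ∧
    (minGenerators (I ^ 2) : ℤ) = l * minGenerators I - l.choose 2

end

/-- The cover ideal `J(G) = ⋂ (x_u, x_v)`, the intersection over all edges `{u, v}` of `G`. -/
noncomputable def coverIdeal (k : Type*) [Field k] {V : Type*} (G : SimpleGraph V) :
    Ideal (MvPolynomial V k) :=
  ⨅ (u : V) (v : V) (_ : G.Adj u v), Ideal.span {X u, X v}

/-- The graph `A_{n,m}` (for `n, m ≥ 1`): the complete graphs on `x_1, …, x_n` and on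
`x_n, y_2, …, y_m`, sharing the vertex `x_n`. Here `x_i` is `inl (i - 1)` and `y_j` is
`inr (j - 2)`. -/
def sharedVertexGraph (n m : ℕ) : SimpleGraph (Fin n ⊕ Fin (m - 1)) where
  Adj
    | .inl i, .inl j => i ≠ j
    | .inr i, .inr j => i ≠ j
    | .inl i, .inr _ => (i : ℕ) + 1 = n
    | .inr _, .inl i => (i : ℕ) + 1 = n
  symm := ⟨by rintro (i | i) (j | j) h <;> first | exact h.symm | exact h⟩
  loopless := ⟨by rintro (i | i) h <;> exact h rfl⟩

/-! Put `a = n - 1` and `b = m - 1`. A minimal vertex cover omits a maximal independent set, which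
is either the shared vertex or a pair consisting of one unshared vertex from each complete graph. So
`I` is generated by `u` and the `u_ij`, which are `a * b + 1` monomials. Giving the shared vertex
weight 2 and every other vertex weight 1 puts them all in degree `a + b`.

For a monomial ideal generated in one positive weighted degree, the fiber cone is the toric ring
spanned by products of generators (`ker_leadingPartHom`, `range_leadingPartHom`), so its dimension
is a transcendence degree. Here the relations `u_ij u_i'j' = u_i'j u_ij'` make it a Segre ring with
one free variable `u` adjoined. The elements `u`, `u_0j`, `u_i0` form a transcendence basis with `a
+ b` members.

The same relations show that `u_ij u_i'j'` depends only on the multisets `{i, i'}` and `{j, j'}`.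
This gives `μ(I^2) = (a * b + 1) + (a+1 choose 2) * (b+1 choose 2)`. The defect in the Freiman
equation is then `(n-2 choose 2) * (m-2 choose 2)`, which for `n ≤ m` vanishes exactly when `n ≤ 3`.
-/

/-! ### Krull dimension and transcendence degree. -/

/-- An injective integral extension preserves the Krull dimension. -/
theorem ringKrullDim_eq_of_isIntegral_of_injective {A B : Type*} [CommRing A] [CommRing B]
    [Algebra A B] [Algebra.IsIntegral A B] (h : Function.Injective (algebraMap A B)) :
    ringKrullDim B = ringKrullDim A := by
  apply le_antisymm
  -- Incomparability: contraction of primes is strictly monotone.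
  · refine Order.krullDim_le_of_strictMono
      (fun p : PrimeSpectrum B => PrimeSpectrum.comap (algebraMap A B) p) fun p q hpq => ?_
    exact Ideal.IsIntegral.comap_lt_comap (I := p.asIdeal) (J := q.asIdeal) hpq
  · refine iSup_le fun s => ?_
    have : FaithfulSMul A B := (faithfulSMul_iff_algebraMap_injective A B).2 h
    -- Lying over starts a chain in `B`; going up lifts the rest.
    obtain ⟨⟨P, hP, hPs⟩⟩ := Ideal.nonempty_primesOver (S := B) s.head.asIdeal
    obtain ⟨t, ht, -⟩ := Ideal.exists_ltSeries_of_hasGoingUp s P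
    rw [← ht]
    exact le_iSup (fun t : LTSeries (PrimeSpectrum B) => (t.length : WithBot ℕ∞)) t

/-- The Krull dimension of a finitely generated domain over a field is its transcendence degree. -/
theorem ringKrullDim_eq_of_trdeg_eq (k : Type*) {A : Type*} [Field k] [CommRing A] [IsDomain A]
    [Algebra k A] [Algebra.FiniteType k A] {n : ℕ} (h : Algebra.trdeg k A = n) :
    ringKrullDim A = n := by
  obtain ⟨s, g, hg, hint⟩ := exists_integral_inj_algHom_of_fg k A
  let _ := g.toRingHom.toAlgebra
  have : Algebra.IsIntegral (MvPolynomial (Fin s) k) A := ⟨hint⟩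
  have : IsScalarTower k (MvPolynomial (Fin s) k) A := .of_algebraMap_eq fun x => (g.commutes x).symm
  have hinj : Function.Injective (algebraMap (MvPolynomial (Fin s) k) A) := hg
  have hf : FaithfulSMul (MvPolynomial (Fin s) k) A :=
    (faithfulSMul_iff_algebraMap_injective _ _).2 hinj
  -- Over its Noether normalization `A` is algebraic, so the number of variables is the
  -- transcendence degree.
  have ht := lift_trdeg_add_eq k (MvPolynomial (Fin s) k) A
  rw [trdeg_eq_zero (R := MvPolynomial (Fin s) k), h] at ht
  have hs : s = n := by
    simp only [MvPolynomial.trdeg_of_isDomain, Cardinal.mk_fin, Cardinal.lift_natCast,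
      Cardinal.lift_zero, add_zero] at ht
    exact_mod_cast ht
  rw [ringKrullDim_eq_of_isIntegral_of_injective hinj,
    MvPolynomial.ringKrullDim_of_isNoetherianRing, ringKrullDim_eq_zero_of_field, hs]
  simp

/-- Monomials with linearly independent exponents are algebraically independent. -/
theorem algebraicIndependent_monomial {k σ ι : Type*} [Field k] (c : ι → σ →₀ ℕ)
    (hc : Function.Injective (fun e : ι →₀ ℕ => e.sum fun i n => n • c i)) :
    AlgebraicIndependent k (fun i => monomial (c i) (1 : k)) := by
  classical
  rw [algebraicIndependent_iff_injective_aeval, injective_iff_map_eq_zero]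
  intro p hp
  ext e
  have key : ∀ e : ι →₀ ℕ, (aeval fun i => monomial (c i) (1 : k)) (monomial e (p.coeff e)) =
      monomial (e.sum fun i n => n • c i) (p.coeff e) := by
    intro e
    rw [aeval_monomial, MvPolynomial.algebraMap_eq]
    simp only [monomial_pow, one_pow]
    rw [Finsupp.prod, ← MvPolynomial.monomial_sum_one, C_mul_monomial, mul_one]
    rfl
  -- By injectivity of the exponent map, only the term `e` of `p` contributes to this coefficient.
  have h := congrArg (coeff (e.sum fun i n => n • c i)) hp
  rw [p.as_sum, map_sum, coeff_sum] at h
  simp only [key, coeff_monomial] at h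
  rw [Finset.sum_eq_single e] at h
  · simpa using h
  · intro b _ hb
    exact if_neg fun h => hb (hc h)
  · intro he
    simpa using he

/-! ### Monomial ideals and their minimal generators. -/

section MonomialIdeal

open scoped Pointwise

variable {k σ : Type*} [Field k]

variable (k) in
/-- The ideal generated by the monomials with exponents in `S`. -/
noncomputable def monomialIdeal (S : Set (σ →₀ ℕ)) : Ideal (MvPolynomial σ k) :=
  Ideal.span ((fun c => monomial c (1 : k)) '' S)

theorem mem_monomialIdeal {S : Set (σ →₀ ℕ)} {f : MvPolynomial σ k} :
    f ∈ monomialIdeal k S ↔ ∀ x ∈ f.support, ∃ c ∈ S, c ≤ x :=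
  mem_ideal_span_monomial_image

theorem monomial_mem_monomialIdeal_iff {S : Set (σ →₀ ℕ)} {x : σ →₀ ℕ} :
    monomial x (1 : k) ∈ monomialIdeal k S ↔ ∃ c ∈ S, c ≤ x := by
  classical
  simp [mem_monomialIdeal, support_monomial]

theorem monomialIdeal_mul (S T : Set (σ →₀ ℕ)) :
    monomialIdeal k S * monomialIdeal k T = monomialIdeal k (S + T) := by
  rw [monomialIdeal, monomialIdeal, Ideal.span_mul_span', monomialIdeal, ← Set.image2_mul,
    ← Set.image2_add, Set.image2_image_left, Set.image2_image_right, Set.image_image2]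
  simp [monomial_mul]

theorem minimalExponents_monomialIdeal {S : Set (σ →₀ ℕ)} (hS : IsAntichain (· ≤ ·) S) :
    minimalExponents (monomialIdeal k S) = S := by
  ext c
  simp only [minimalExponents, Set.mem_ofPred_eq, monomial_mem_monomialIdeal_iff]
  constructor
  · rintro ⟨⟨e, he, hec⟩, hmin⟩
    rwa [(hmin ⟨e, he, le_rfl⟩ hec).antisymm hec]
  · refine fun hc => ⟨⟨c, hc, le_rfl⟩, ?_⟩
    rintro x ⟨e, he, hex⟩ hxc
    rwa [← hS.eq he hc (hex.trans hxc)]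

/-- The minimal number of generators of a monomial ideal with a finite antichain of exponents. -/
theorem minGenerators_monomialIdeal {S : Set (σ →₀ ℕ)} (hfin : S.Finite)
    (hS : IsAntichain (· ≤ ·) S) : minGenerators (monomialIdeal k S) = S.ncard := by
  classical
  apply le_antisymm
  · exact (Submodule.spanFinrank_span_le_ncard_of_finite (hfin.image _)).trans
      (Set.ncard_image_le hfin)
  · have := hfin.fintype
    have hfg : (monomialIdeal k S).FG := 
      ⟨(hfin.image fun c => monomial c (1 : k)).toFinset, by simp [monomialIdeal]⟩
    obtain ⟨s, hcard, hs⟩ := Submodule.FG.exists_span_finset_card_eq_spanFinrank hfg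
    rw [minGenerators, ← hcard]
    let π : MvPolynomial σ k →ₗ[k] (S → k) := LinearMap.pi fun c => lcoeff k (c : σ →₀ ℕ)
    have hπ (f : MvPolynomial σ k) (c : S) : π f c = coeff (c : σ →₀ ℕ) f := rfl
    -- On the ideal, `π` sees only the constant term of a multiplier, because no proper multiple of
    -- a generator has its exponent in the antichain `S`. So `π` of any generating set spans `k^S`
    -- over `k`.
    have hmul (a f : MvPolynomial σ k) (hf : f ∈ monomialIdeal k S) :
        π (a * f) = coeff 0 a • π f := by
      ext c
      rw [hπ, Pi.smul_apply, hπ, coeff_mul, smul_eq_mul,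
        Finset.sum_eq_single (0, (c : σ →₀ ℕ))]
      · rintro ⟨x, y⟩ hxy hne
        rw [Finset.HasAntidiagonal.mem_antidiagonal] at hxy
        by_contra h
        have hy : y ∈ f.support := mem_support_iff.2 (right_ne_zero_of_mul h)
        obtain ⟨e, he, hey⟩ := mem_monomialIdeal.1 hf y hy
        have hyc : y ≤ c := hxy ▸ le_add_self
        have hec := hS.eq he c.2 (hey.trans hyc)
        have hy' : y = c := hyc.antisymm (hec ▸ hey)
        refine hne (Prod.ext ?_ hy')
        simpa [hy'] using hxy
      · simp
    have hspan : ∀ f ∈ monomialIdeal k S,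
        f ∈ monomialIdeal k S ∧ π f ∈ Submodule.span k (s.image π : Set (S → k)) := by
      intro f hf
      rw [← hs] at hf
      refine Submodule.span_induction ?_ ?_ ?_ ?_ hf
      · intro x hx
        exact ⟨hs ▸ Submodule.subset_span hx,
          Submodule.subset_span (by simpa using ⟨x, hx, rfl⟩)⟩
      · simp
      · rintro x y - - ⟨hx, hx'⟩ ⟨hy, hy'⟩
        exact ⟨add_mem hx hy, by rw [map_add]; exact add_mem hx' hy'⟩
      · rintro a x - ⟨hx, hx'⟩
        refine ⟨Submodule.smul_mem _ _ hx, ?_⟩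
        rw [smul_eq_mul, hmul a x hx]
        exact Submodule.smul_mem _ _ hx'
    have htop : Submodule.span k (s.image π : Set (S → k)) = ⊤ := by
      rw [eq_top_iff, ← (Pi.basisFun k S).span_eq, Submodule.span_le]
      rintro _ ⟨c, rfl⟩
      have h := (hspan _ (Ideal.subset_span ⟨c, c.2, rfl⟩)).2
      convert! h using 1
      ext e
      simp [hπ, coeff_monomial, Pi.single_apply, Subtype.ext_iff, eq_comm]
    have hrank := finrank_span_finset_le_card (R := k) (s.image π)
    rw [Set.finrank, htop, finrank_top, Module.finrank_fintype_fun_eq_card] at hrank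
    rw [← Nat.card_coe_set_eq, Nat.card_eq_fintype_card]
    exact hrank.trans Finset.card_image_le

/-- A proper divisor has strictly smaller weight when all weights are positive. -/
theorem isAntichain_of_weight_eq {w : σ → ℕ} (hw : ∀ i, w i ≠ 0) {S : Set (σ →₀ ℕ)} {d : ℕ}
    (hS : ∀ c ∈ S, Finsupp.weight w c = d) : IsAntichain (· ≤ ·) S := by
  intro c hc e he hne hle
  obtain ⟨r, rfl⟩ := exists_add_of_le hle
  have h := hS _ he
  rw [map_add, hS _ hc, Nat.add_eq_left] at h
  have : Finsupp.NonTorsionWeight ℕ w := Finsupp.nonTorsionWeight_of ℕ _ hw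
  rw [Finsupp.weight_eq_zero_iff_eq_zero] at h
  exact hne (by simp [h])

theorem isQuasiEquigenerated_monomialIdeal {w : σ → ℕ} (hw : ∀ i, w i ≠ 0)
    {S : Set (σ →₀ ℕ)} {d : ℕ} (hS : ∀ c ∈ S, Finsupp.weight w c = d) :
    IsQuasiEquigenerated (monomialIdeal k S) := by
  refine ⟨⟨S, rfl⟩, w, d, fun i => Nat.one_le_iff_ne_zero.2 (hw i), fun c hc => ?_⟩
  rw [minimalExponents_monomialIdeal (isAntichain_of_weight_eq hw hS)] at hc
  simpa [Finsupp.weight_apply, mul_comm] using hS c hc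

/-! ### The fiber cone as a toric ring. -/

/-- Lowest weighted degree parts multiply. -/
theorem weightedHomogeneousComponent_add_mul (w : σ → ℕ) {D E : ℕ} {f g : MvPolynomial σ k}
    (hf : ∀ x ∈ f.support, D ≤ Finsupp.weight w x)
    (hg : ∀ x ∈ g.support, E ≤ Finsupp.weight w x) :
    weightedHomogeneousComponent w (D + E) (f * g) =
      weightedHomogeneousComponent w D f * weightedHomogeneousComponent w E g := by
  classical
  ext c
  rw [coeff_weightedHomogeneousComponent, coeff_mul, coeff_mul]
  simp only [coeff_weightedHomogeneousComponent]
  split_ifs with hc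
  · refine Finset.sum_congr rfl fun p hp => ?_
    rw [Finset.HasAntidiagonal.mem_antidiagonal] at hp
    by_cases h1 : coeff p.1 f = 0
    · simp [h1]
    by_cases h2 : coeff p.2 g = 0
    · simp [h2]
    have h1' := hf _ (mem_support_iff.2 h1)
    have h2' := hg _ (mem_support_iff.2 h2)
    rw [← hp, map_add] at hc
    rw [if_pos (by omega), if_pos (by omega)]
  · refine (Finset.sum_eq_zero fun p hp => ?_).symm
    rw [Finset.HasAntidiagonal.mem_antidiagonal] at hp
    split_ifs with h1 h2 <;> simp
    exact absurd (by rw [← hp, map_add, h1, h2]) hc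

/-- The powers of an ideal generated by monomials. -/
theorem exists_monomialIdeal_pow_eq {w : σ → ℕ} {S : Set (σ →₀ ℕ)} {d : ℕ}
    (hS : ∀ c ∈ S, Finsupp.weight w c = d) (i : ℕ) :
    ∃ T : Set (σ →₀ ℕ), monomialIdeal k S ^ i = monomialIdeal k T ∧
      (∀ c ∈ T, Finsupp.weight w c = d * i) ∧
      ∀ c ∈ T, monomial c (1 : k) ∈ Algebra.adjoin k ((fun c => monomial c (1 : k)) '' S) := by
  induction i with
  | zero =>
    refine ⟨{0}, ?_, by simp, ?_⟩
    · simp [monomialIdeal]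
    · rintro _ rfl
      exact one_mem _
  | succ i ih =>
    obtain ⟨T, hT, hw, hmem⟩ := ih
    refine ⟨T + S, by rw [pow_succ, hT, monomialIdeal_mul], ?_, ?_⟩
    · rintro _ ⟨x, hx, y, hy, rfl⟩
      simp [hw x hx, hS y hy, mul_add]
    · rintro _ ⟨x, hx, y, hy, rfl⟩
      have := mul_mem (hmem x hx) (Algebra.subset_adjoin (R := k) (Set.mem_image_of_mem _ hy))
      simpa [monomial_mul] using this

variable (k) in
/-- The map sending `∑ fᵢ tⁱ` to the sum of the parts of `fᵢ` of weighted degree `d * i`. -/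
noncomputable def leadingPart (w : σ → ℕ) (d : ℕ) :
    Polynomial (MvPolynomial σ k) →ₗ[k] MvPolynomial σ k :=
  Polynomial.lsum fun i => (weightedHomogeneousComponent w (d * i))

theorem leadingPart_monomial (w : σ → ℕ) (d i : ℕ) (f : MvPolynomial σ k) :
    leadingPart k w d (Polynomial.monomial i f) = weightedHomogeneousComponent w (d * i) f := by
  simp [leadingPart, Polynomial.lsum_apply]

theorem leadingPart_apply (w : σ → ℕ) (d : ℕ) (f : Polynomial (MvPolynomial σ k)) :
    leadingPart k w d f =
      ∑ i ∈ f.support, weightedHomogeneousComponent w (d * i) (f.coeff i) := by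
  simp [leadingPart, Polynomial.lsum_apply, Polynomial.sum]

theorem le_weight_of_mem_pow {w : σ → ℕ} {S : Set (σ →₀ ℕ)} {d : ℕ}
    (hS : ∀ c ∈ S, Finsupp.weight w c = d) {i : ℕ} {f : MvPolynomial σ k}
    (hf : f ∈ monomialIdeal k S ^ i) (x : σ →₀ ℕ) (hx : x ∈ f.support) :
    d * i ≤ Finsupp.weight w x := by
  obtain ⟨T, hT, hw, -⟩ := exists_monomialIdeal_pow_eq (k := k) hS i
  rw [hT] at hf
  obtain ⟨c, hc, hcx⟩ := mem_monomialIdeal.1 hf x hx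
  obtain ⟨r, rfl⟩ := exists_add_of_le hcx
  rw [map_add, hw c hc]
  exact Nat.le_add_right _ _

/-- On the Rees algebra of an equigenerated monomial ideal, taking leading parts
is multiplicative. -/
noncomputable def leadingPartHom {w : σ → ℕ} {S : Set (σ →₀ ℕ)} {d : ℕ}
    (hS : ∀ c ∈ S, Finsupp.weight w c = d) :
    reesAlgebra (monomialIdeal k S) →ₐ[k] MvPolynomial σ k :=
  AlgHom.ofLinearMap
    (leadingPart k w d ∘ₗ ((reesAlgebra (monomialIdeal k S)).val.restrictScalars k).toLinearMap)
    (by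
      change leadingPart k w d 1 = 1
      rw [← Polynomial.monomial_zero_one, leadingPart_monomial, mul_zero]
      exact (isWeightedHomogeneous_one k w).weightedHomogeneousComponent_same)
    (by
      intro f g
      change leadingPart k w d (f * g : Polynomial (MvPolynomial σ k)) =
        leadingPart k w d f * leadingPart k w d g
      rw [Polynomial.mul_eq_sum_sum, leadingPart_apply w d (f : Polynomial (MvPolynomial σ k)),
        leadingPart_apply w d (g : Polynomial (MvPolynomial σ k)), Finset.sum_mul_sum, map_sum]
      refine Finset.sum_congr rfl fun i _ => ?_
      rw [Polynomial.sum, map_sum]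
      refine Finset.sum_congr rfl fun j _ => ?_
      rw [leadingPart_monomial, mul_add]
      exact weightedHomogeneousComponent_add_mul w (le_weight_of_mem_pow hS (f.2 i))
        (le_weight_of_mem_pow hS (g.2 j)))

theorem leadingPartHom_apply {w : σ → ℕ} {S : Set (σ →₀ ℕ)} {d : ℕ}
    (hS : ∀ c ∈ S, Finsupp.weight w c = d) (f : reesAlgebra (monomialIdeal k S)) :
    leadingPartHom hS f = leadingPart k w d f := rfl

/-- Since `d ≠ 0`, distinct powers of `t` land in distinct degrees `d * i`, so forgetting `t` loses
nothing. -/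
theorem weightedHomogeneousComponent_leadingPart (w : σ → ℕ) {d : ℕ} (hd : d ≠ 0)
    (f : Polynomial (MvPolynomial σ k)) (i : ℕ) :
    weightedHomogeneousComponent w (d * i) (leadingPart k w d f) =
      weightedHomogeneousComponent w (d * i) (f.coeff i) := by
  rw [leadingPart_apply, map_sum, Finset.sum_eq_single i]
  · exact (weightedHomogeneousComponent_isWeightedHomogeneous
      (d * i) (f.coeff i)).weightedHomogeneousComponent_same
  · intro j _ hj
    refine (weightedHomogeneousComponent_isWeightedHomogeneous
      (d * j) (f.coeff j)).weightedHomogeneousComponent_ne _ fun h => hj ?_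
    exact Nat.eq_of_mul_eq_mul_left (Nat.pos_of_ne_zero hd) h.symm
  · intro hi
    simp [Polynomial.notMem_support_iff.1 hi]

/-- The generators of the `i`-th power have weight `d * i`, so every monomial of `f` is a proper
multiple of one of them. -/
theorem mem_idealOfVars_mul_pow {w : σ → ℕ} {S : Set (σ →₀ ℕ)} {d : ℕ}
    (hS : ∀ c ∈ S, Finsupp.weight w c = d) {i : ℕ} {f : MvPolynomial σ k}
    (hf : f ∈ monomialIdeal k S ^ i) (h0 : weightedHomogeneousComponent w (d * i) f = 0) :
    f ∈ idealOfVars σ k * monomialIdeal k S ^ i := by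
  classical
  obtain ⟨T, hT, hwT, -⟩ := exists_monomialIdeal_pow_eq (k := k) hS i
  rw [hT] at hf ⊢
  rw [f.as_sum]
  refine Ideal.sum_mem _ fun x hx => ?_
  obtain ⟨c, hc, hcx⟩ := mem_monomialIdeal.1 hf x hx
  obtain ⟨r, rfl⟩ := exists_add_of_le hcx
  have hr : r ≠ 0 := by
    rintro rfl
    have h := congrArg (coeff (c + 0)) h0
    rw [coeff_weightedHomogeneousComponent, if_pos (by simpa using hwT c hc)] at h
    exact mem_support_iff.1 hx (by simpa using h)
  have hsplit : monomial (c + r) (coeff (c + r) f) =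
      monomial r (coeff (c + r) f) * monomial c (1 : k) := by
    rw [monomial_mul, mul_one, add_comm]
  rw [hsplit]
  refine Ideal.mul_mem_mul ?_ (Ideal.subset_span ⟨c, hc, rfl⟩)
  obtain ⟨j, hj⟩ := Finsupp.ne_iff.1 hr
  rw [idealOfVars, ← Set.image_univ, mem_ideal_span_X_image]
  intro m hm
  rw [Finset.mem_singleton.1 (support_monomial_subset hm)]
  exact ⟨j, trivial, hj⟩

theorem ker_leadingPartHom {w : σ → ℕ} (hw : ∀ i, w i ≠ 0) {S : Set (σ →₀ ℕ)} {d : ℕ}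
    (hd : d ≠ 0) (hS : ∀ c ∈ S, Finsupp.weight w c = d) :
    RingHom.ker (leadingPartHom (k := k) hS) =
      (idealOfVars σ k).map
        (algebraMap (MvPolynomial σ k) (reesAlgebra (monomialIdeal k S))) := by
  apply le_antisymm
  · intro f hf
    rw [RingHom.mem_ker, leadingPartHom_apply] at hf
    rw [mem_map_algebraMap_reesAlgebra_iff]
    intro i
    refine mem_idealOfVars_mul_pow hS (f.2 i) ?_
    rw [← weightedHomogeneousComponent_leadingPart w hd, hf, map_zero]
  · rw [Ideal.map_le_iff_le_comap, idealOfVars, Ideal.span_le]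
    rintro _ ⟨j, rfl⟩
    change leadingPart k w d (Polynomial.C (X j)) = 0
    rw [← Polynomial.monomial_zero_left, leadingPart_monomial, mul_zero]
    exact (isWeightedHomogeneous_X k w j).weightedHomogeneousComponent_ne _ (hw j).symm

theorem range_leadingPartHom {w : σ → ℕ} (hw : ∀ i, w i ≠ 0) {S : Set (σ →₀ ℕ)} {d : ℕ}
    (hS : ∀ c ∈ S, Finsupp.weight w c = d) :
    (leadingPartHom (k := k) hS).range =
      Algebra.adjoin k ((fun c => monomial c (1 : k)) '' S) := by
  classical
  apply le_antisymm
  · rintro _ ⟨f, rfl⟩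
    change leadingPart k w d f ∈ _
    rw [leadingPart_apply]
    refine sum_mem fun i _ => ?_
    obtain ⟨T, hT, hwT, hmem⟩ := exists_monomialIdeal_pow_eq (k := k) hS i
    have hf := f.2 i
    rw [hT] at hf
    rw [(weightedHomogeneousComponent w (d * i) _).as_sum]
    refine sum_mem fun x hx => ?_
    rw [support_weightedHomogeneousComponent, Finset.mem_filter] at hx
    obtain ⟨c, hc, hcx⟩ := mem_monomialIdeal.1 hf x hx.1
    obtain ⟨r, rfl⟩ := exists_add_of_le hcx
    -- The cofactor `r` has weight zero, hence is trivial: the lowest-degree part involves only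
    -- products of generators.
    have : Finsupp.NonTorsionWeight ℕ w := Finsupp.nonTorsionWeight_of ℕ _ hw
    have hr := hx.2
    rw [map_add, hwT c hc, Nat.add_eq_left, Finsupp.weight_eq_zero_iff_eq_zero] at hr
    subst hr
    rw [add_zero, ← mul_one (coeff c _), ← smul_eq_mul, ← smul_monomial]
    exact Subalgebra.smul_mem _ (hmem c hc) _
  · rw [Algebra.adjoin_le_iff]
    rintro _ ⟨c, hc, rfl⟩
    refine ⟨⟨Polynomial.monomial 1 (monomial c 1), reesAlgebra.monomial_mem.2 ?_⟩, ?_⟩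
    · rw [pow_one]
      exact Ideal.subset_span ⟨c, hc, rfl⟩
    · change leadingPart k w d (Polynomial.monomial 1 _) = _
      rw [leadingPart_monomial, mul_one]
      exact (isWeightedHomogeneous_monomial w c 1 (hS c hc)).weightedHomogeneousComponent_same

/-- The analytic spread of an equigenerated monomial ideal is the dimension of its toric ring. -/
theorem analyticSpread_monomialIdeal {w : σ → ℕ} (hw : ∀ i, w i ≠ 0) {S : Set (σ →₀ ℕ)} {d : ℕ}
    (hd : d ≠ 0) (hS : ∀ c ∈ S, Finsupp.weight w c = d) :
    analyticSpread (monomialIdeal k S) =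
      ringKrullDim (Algebra.adjoin k ((fun c => monomial c (1 : k)) '' S)) := by
  rw [← range_leadingPartHom hw hS]
  exact ringKrullDim_eq_of_ringEquiv
    ((Ideal.quotEquivOfEq (ker_leadingPartHom hw hd hS).symm).trans
      (RingHom.quotientKerEquivRange (leadingPartHom (k := k) hS).toRingHom))

end MonomialIdeal

/-! ### Minimal vertex covers of the graph. -/

section SharedVertexGraph

open scoped Pointwise

variable {k : Type*} [Field k]

theorem mem_coverIdeal_iff {V : Type*} {G : SimpleGraph V} {f : MvPolynomial V k} :
    f ∈ coverIdeal k G ↔ ∀ x ∈ f.support, ∀ u v, G.Adj u v → x u ≠ 0 ∨ x v ≠ 0 := by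
  have h (u v : V) : f ∈ Ideal.span {X u, X v} ↔ ∀ x ∈ f.support, x u ≠ 0 ∨ x v ≠ 0 := by
    rw [← Set.image_pair, mem_ideal_span_X_image]
    simp
  simp only [coverIdeal, Ideal.mem_iInf, h]
  exact ⟨fun H x hx u v huv => H u v huv x hx, fun H u v huv x hx => H x hx u v huv⟩

/-- The minimal vertex covers of `sharedVertexGraph (a + 1) (b + 1)`: all vertices but the shared
one, and all vertices but one unshared vertex of each complete graph. -/
noncomputable def coverExponent (a b : ℕ) :
    Option (Fin a × Fin b) → (Fin (a + 1) ⊕ Fin b →₀ ℕ)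
  | none => Finsupp.equivFunOnFinite.symm
      (Sum.elim (fun i => if i = Fin.last a then 0 else 1) fun _ => 1)
  | some p => Finsupp.equivFunOnFinite.symm
      (Sum.elim (fun i => if i = p.1.castSucc then 0 else 1) fun j => if j = p.2 then 0 else 1)

@[simp] theorem coverExponent_none_inl (a b : ℕ) (i : Fin (a + 1)) :
    coverExponent a b none (.inl i) = if i = Fin.last a then 0 else 1 := rfl

@[simp] theorem coverExponent_none_inr (a b : ℕ) (j : Fin b) :
    coverExponent a b none (.inr j) = 1 := rfl

@[simp] theorem coverExponent_some_inl (a b : ℕ) (p : Fin a × Fin b) (i : Fin (a + 1)) :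
    coverExponent a b (some p) (.inl i) = if i = p.1.castSucc then 0 else 1 := rfl

@[simp] theorem coverExponent_some_inr (a b : ℕ) (p : Fin a × Fin b) (j : Fin b) :
    coverExponent a b (some p) (.inr j) = if j = p.2 then 0 else 1 := rfl

/-- Weight two on the shared vertex, one on all others. -/
def coverWeight (a b : ℕ) : Fin (a + 1) ⊕ Fin b → ℕ :=
  Sum.elim (fun i => if i = Fin.last a then 2 else 1) fun _ => 1

theorem coverWeight_ne_zero (a b : ℕ) (v : Fin (a + 1) ⊕ Fin b) : coverWeight a b v ≠ 0 := by
  rcases v with i | j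
  · simp only [coverWeight, Sum.elim_inl]
    split_ifs <;> simp
  · simp [coverWeight]

theorem sum_ite_zero_add {ι M : Type*} [Fintype ι] [DecidableEq ι] [AddCommMonoid M] (f : ι → M)
    (i : ι) : (∑ j, if j = i then 0 else f j) + f i = ∑ j, f j := by
  rw [← Finset.sum_erase_add _ _ (Finset.mem_univ i), if_pos rfl, add_zero,
    ← Finset.sum_erase_add _ f (Finset.mem_univ i)]
  congr 1
  exact Finset.sum_congr rfl fun j hj => if_neg (Finset.ne_of_mem_erase hj)

theorem weight_coverExponent (a b : ℕ) (p : Option (Fin a × Fin b)) :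
    Finsupp.weight (coverWeight a b) (coverExponent a b p) = a + b := by
  rw [Finsupp.weight_eq_sum, Fintype.sum_sum_type, Fin.sum_univ_castSucc]
  rcases p with _ | ⟨i, j⟩
  · simp [coverWeight, Fin.castSucc_ne_last]
  · have h1 := sum_ite_zero_add (fun _ : Fin a => 1) i
    have h2 := sum_ite_zero_add (fun _ : Fin b => 1) j
    simp only [Finset.sum_const, Finset.card_univ, Fintype.card_fin, smul_eq_mul, mul_one] at h1 h2
    simp [coverWeight, Fin.castSucc_ne_last, (Fin.castSucc_ne_last _).symm]
    omega

theorem weight_of_mem_range_coverExponent (a b : ℕ) :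
    ∀ c ∈ Set.range (coverExponent a b), Finsupp.weight (coverWeight a b) c = a + b := by
  rintro _ ⟨p, rfl⟩
  exact weight_coverExponent a b p

theorem coverIdeal_sharedVertexGraph {a b : ℕ} (ha : a ≠ 0) (hb : b ≠ 0) :
    coverIdeal k (sharedVertexGraph (a + 1) (b + 1)) =
      monomialIdeal k (Set.range (coverExponent a b)) := by
  have := NeZero.mk ha
  have := NeZero.mk hb
  ext f
  rw [mem_coverIdeal_iff, mem_monomialIdeal]
  refine forall₂_congr fun x _ => ?_
  change (∀ u v : Fin (a + 1) ⊕ Fin b, (sharedVertexGraph (a + 1) (b + 1)).Adj u v → _) ↔ _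
  simp only [Set.exists_range_iff]
  constructor
  · intro h
    have hl (i i' : Fin (a + 1)) (hne : i ≠ i') : x (.inl i) ≠ 0 ∨ x (.inl i') ≠ 0 :=
      h (.inl i) (.inl i') hne
    have hr (j j' : Fin b) (hne : j ≠ j') : x (.inr j) ≠ 0 ∨ x (.inr j') ≠ 0 :=
      h (.inr j) (.inr j') hne
    have hlr (j : Fin b) : x (.inl (Fin.last a)) ≠ 0 ∨ x (.inr j) ≠ 0 :=
      h (.inl (Fin.last a)) (.inr j) rfl
    -- A cover missing the shared vertex contains all others; one containing it misses at most one
    -- unshared vertex on each side.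
    by_cases hz : x (.inl (Fin.last a)) = 0
    · refine ⟨none, ?_⟩
      rintro (i | j)
      · rw [coverExponent_none_inl]
        split_ifs with hi
        · exact Nat.zero_le _
        · exact Nat.one_le_iff_ne_zero.2 ((hl i _ hi).resolve_right (not_not.2 hz))
      · exact Nat.one_le_iff_ne_zero.2 ((hlr j).resolve_left (not_not.2 hz))
    · obtain ⟨i, hi⟩ : ∃ i : Fin a, ∀ i', i' ≠ i.castSucc → x (.inl i') ≠ 0 := by
        by_cases hex : ∃ i : Fin a, x (.inl i.castSucc) = 0
        · obtain ⟨i, hi⟩ := hex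
          exact ⟨i, fun i' hne => (hl _ _ hne).resolve_right (not_not.2 hi)⟩
        -- Nothing is missing on this side, so any vertex may be dropped.
        · refine ⟨0, fun i' _ => ?_⟩
          induction i' using Fin.lastCases with
          | last => exact hz
          | cast i' => exact fun h0 => hex ⟨i', h0⟩
      obtain ⟨j, hj⟩ : ∃ j : Fin b, ∀ j', j' ≠ j → x (.inr j') ≠ 0 := by
        by_cases hex : ∃ j : Fin b, x (.inr j) = 0
        · obtain ⟨j, hj⟩ := hex
          exact ⟨j, fun j' hne => (hr _ _ hne).resolve_right (not_not.2 hj)⟩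
        · exact ⟨0, fun j' _ h0 => hex ⟨j', h0⟩⟩
      refine ⟨some (i, j), ?_⟩
      rintro (i' | j')
      · rw [coverExponent_some_inl]
        split_ifs with h0
        · exact Nat.zero_le _
        · exact Nat.one_le_iff_ne_zero.2 (hi i' h0)
      · rw [coverExponent_some_inr]
        split_ifs with h0
        · exact Nat.zero_le _
        · exact Nat.one_le_iff_ne_zero.2 (hj j' h0)
  · rintro ⟨p, hp⟩ u v huv
    suffices coverExponent a b p u ≠ 0 ∨ coverExponent a b p v ≠ 0 from
      this.imp (fun h0 => ((Nat.pos_of_ne_zero h0).trans_le (hp u)).ne')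
        fun h0 => ((Nat.pos_of_ne_zero h0).trans_le (hp v)).ne'
    have hlast (i : Fin (a + 1)) (hi : (i : ℕ) + 1 = a + 1) : i = Fin.last a :=
      Fin.ext (Nat.succ.inj hi)
    rcases u with i | j <;> rcases v with i' | j' <;> rcases p with _ | ⟨i₀, j₀⟩
    · have huv : i ≠ i' := huv
      simp only [coverExponent_none_inl]
      grind
    · have huv : i ≠ i' := huv
      simp only [coverExponent_some_inl]
      grind
    · simp
    · rw [hlast i huv]
      simp [(Fin.castSucc_ne_last _).symm]
    · simp
    · rw [hlast i' huv]
      simp [(Fin.castSucc_ne_last _).symm]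
    · simp
    · have huv : j ≠ j' := huv
      simp only [coverExponent_some_inr]
      grind

theorem coverExponent_injective (a b : ℕ) : Function.Injective (coverExponent a b) := by
  rintro (_ | ⟨i, j⟩) (_ | ⟨i', j'⟩) h
  · rfl
  · simpa [(Fin.castSucc_ne_last _).symm] using DFunLike.congr_fun h (.inl (Fin.last a))
  · simpa [(Fin.castSucc_ne_last _).symm] using DFunLike.congr_fun h (.inl (Fin.last a))
  · have h1 := DFunLike.congr_fun h (.inl i.castSucc)
    have h2 := DFunLike.congr_fun h (.inr j)
    simp only [coverExponent_some_inl, coverExponent_some_inr, if_true, Fin.castSucc_inj] at h1 h2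
    have h1' : i = i' := by by_contra hne; simp [hne] at h1
    have h2' : j = j' := by by_contra hne; simp [hne] at h2
    rw [h1', h2']

theorem ncard_range_coverExponent (a b : ℕ) : (Set.range (coverExponent a b)).ncard = a * b + 1 := by
  rw [← Set.image_univ, Set.ncard_image_of_injective _ (coverExponent_injective a b),
    Set.ncard_univ, Nat.card_eq_fintype_card, Fintype.card_option, Fintype.card_prod,
    Fintype.card_fin, Fintype.card_fin]

/-! ### Generators of the square. -/

/-- How many of the two entries of a pair differ from a given element. -/
def Sym2.countNe {α : Type*} [DecidableEq α] (p : Sym2 α) (x : α) : ℕ :=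
  Sym2.lift ⟨fun u v => (if x = u then 0 else 1) + if x = v then 0 else 1,
    fun _ _ => add_comm _ _⟩ p

theorem Sym2.countNe_mk {α : Type*} [DecidableEq α] (u v x : α) :
    Sym2.countNe s(u, v) x = (if x = u then 0 else 1) + if x = v then 0 else 1 := rfl

/-- The entries of a pair are where the count drops below 2, with 0 marking a repeated entry; it is
enough to test at the four entries. -/
theorem Sym2.countNe_injective {α : Type*} [DecidableEq α] :
    Function.Injective (Sym2.countNe (α := α)) := by
  intro p q
  induction p with | _ u v
  induction q with | _ u' v'
  intro h
  have h1 := congrFun h u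
  have h2 := congrFun h v
  have h3 := congrFun h u'
  have h4 := congrFun h v'
  simp only [Sym2.countNe_mk] at h1 h2 h3 h4
  rw [Sym2.eq_iff]
  grind

/-- The exponents of the products of two generators. -/
noncomputable def coverSqExponent (a b : ℕ) :
    Option (Fin a × Fin b) ⊕ (Sym2 (Fin a) × Sym2 (Fin b)) → (Fin (a + 1) ⊕ Fin b →₀ ℕ)
  | .inl p => coverExponent a b none + coverExponent a b p
  | .inr q => Finsupp.equivFunOnFinite.symm
      (Sum.elim (Fin.lastCases 2 fun i => q.1.countNe i) fun j => q.2.countNe j)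

theorem coverSqExponent_inr_mk (a b : ℕ) (i i' : Fin a) (j j' : Fin b) :
    coverSqExponent a b (.inr (s(i, i'), s(j, j'))) =
      coverExponent a b (some (i, j)) + coverExponent a b (some (i', j')) := by
  ext (v | v)
  · induction v using Fin.lastCases with
    | last => simp [coverSqExponent, (Fin.castSucc_ne_last _).symm]
    | cast v => simp [coverSqExponent, Sym2.countNe_mk]
  · simp [coverSqExponent, Sym2.countNe_mk]

theorem range_coverSqExponent (a b : ℕ) :
    Set.range (coverSqExponent a b) =
      Set.range (coverExponent a b) + Set.range (coverExponent a b) := by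
  ext c
  constructor
  · rintro ⟨p | ⟨q, q'⟩, rfl⟩
    · exact Set.add_mem_add ⟨_, rfl⟩ ⟨_, rfl⟩
    · induction q with | _ i i'
      induction q' with | _ j j'
      rw [coverSqExponent_inr_mk]
      exact Set.add_mem_add ⟨_, rfl⟩ ⟨_, rfl⟩
  · rintro ⟨_, ⟨p, rfl⟩, _, ⟨q, rfl⟩, rfl⟩
    rcases p with _ | ⟨i, j⟩
    · exact ⟨.inl q, rfl⟩
    · rcases q with _ | ⟨i', j'⟩
      · exact ⟨.inl (some (i, j)), add_comm _ _⟩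
      · exact ⟨_, coverSqExponent_inr_mk a b i i' j j'⟩

/-- The exponent of the shared vertex is 2 for `u_ij u_i'j'` and at most 1 when `u` is a factor,
which separates the two families. Within the first, the other coordinates recover both pairs. -/
theorem coverSqExponent_injective (a b : ℕ) : Function.Injective (coverSqExponent a b) := by
  have hlast (q : Sym2 (Fin a) × Sym2 (Fin b)) :
      coverSqExponent a b (.inr q) (.inl (Fin.last a)) = 2 := by
    simp [coverSqExponent]
  have hle (p : Option (Fin a × Fin b)) :
      coverSqExponent a b (.inl p) (.inl (Fin.last a)) ≤ 1 := by
    rcases p with _ | p <;> simp [coverSqExponent, (Fin.castSucc_ne_last _).symm]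
  rintro (p | q) (p' | q') h
  · exact congrArg _ (coverExponent_injective a b (add_left_cancel h))
  · have := hle p
    rw [h, hlast] at this
    omega
  · have := hle p'
    rw [← h, hlast] at this
    omega
  · refine congrArg _ (Prod.ext ?_ ?_)
    · refine Sym2.countNe_injective (funext fun i => ?_)
      simpa [coverSqExponent] using DFunLike.congr_fun h (.inl i.castSucc)
    · refine Sym2.countNe_injective (funext fun j => ?_)
      simpa [coverSqExponent] using DFunLike.congr_fun h (.inr j)

theorem ncard_range_coverSqExponent (a b : ℕ) :
    (Set.range (coverSqExponent a b)).ncard =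
      a * b + 1 + (a + 1).choose 2 * (b + 1).choose 2 := by
  rw [← Set.image_univ, Set.ncard_image_of_injective _ (coverSqExponent_injective a b),
    Set.ncard_univ, Nat.card_eq_fintype_card, Fintype.card_sum, Fintype.card_option,
    Fintype.card_prod, Fintype.card_prod, Sym2.card, Sym2.card, Fintype.card_fin, Fintype.card_fin]

theorem minGenerators_coverIdeal {a b : ℕ} (ha : a ≠ 0) (hb : b ≠ 0) :
    minGenerators (coverIdeal k (sharedVertexGraph (a + 1) (b + 1))) = a * b + 1 := by
  rw [coverIdeal_sharedVertexGraph ha hb, ← ncard_range_coverExponent]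
  exact minGenerators_monomialIdeal (Set.finite_range _)
    (isAntichain_of_weight_eq (coverWeight_ne_zero a b) (weight_of_mem_range_coverExponent a b))

theorem minGenerators_coverIdeal_sq {a b : ℕ} (ha : a ≠ 0) (hb : b ≠ 0) :
    minGenerators (coverIdeal k (sharedVertexGraph (a + 1) (b + 1)) ^ 2) =
      a * b + 1 + (a + 1).choose 2 * (b + 1).choose 2 := by
  rw [coverIdeal_sharedVertexGraph ha hb, ← ncard_range_coverSqExponent, sq]
  erw [monomialIdeal_mul]
  rw [← range_coverSqExponent]
  refine minGenerators_monomialIdeal (Set.finite_range _)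
    (isAntichain_of_weight_eq (coverWeight_ne_zero a b) (d := a + b + (a + b)) ?_)
  rw [range_coverSqExponent]
  rintro _ ⟨x, hx, y, hy, rfl⟩
  simp [weight_of_mem_range_coverExponent a b x hx, weight_of_mem_range_coverExponent a b y hy]

/-! ### The analytic spread. -/

/-- Exponents whose monomials form a transcendence basis of the toric ring. -/
noncomputable def coverBasisIndex (a b : ℕ) :
    Option (Fin (b + 1) ⊕ Fin a) → Option (Fin (a + 1) × Fin (b + 1))
  | none => none
  | some (.inl j) => some (0, j)
  | some (.inr i) => some (i.succ, 0)

theorem coverBasis_sum_injective (a b : ℕ) : Function.Injective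
    (fun e : Option (Fin (b + 1) ⊕ Fin a) →₀ ℕ =>
      e.sum fun i n => n • coverExponent (a + 1) (b + 1) (coverBasisIndex a b i)) := by
  intro e f h
  have hsum (e : Option (Fin (b + 1) ⊕ Fin a) →₀ ℕ) (v) :
      (e.sum fun i n => n • coverExponent (a + 1) (b + 1) (coverBasisIndex a b i)) v =
        ∑ i, e i * coverExponent (a + 1) (b + 1) (coverBasisIndex a b i) v := by
    rw [Finsupp.sum_fintype _ _ (by simp), Finsupp.finsetSum_apply]
    rfl
  have hv (v) := DFunLike.congr_fun h v
  simp only [hsum] at hv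
  have hw (e : Option (Fin (b + 1) ⊕ Fin a) →₀ ℕ) :
      Finsupp.weight (coverWeight (a + 1) (b + 1))
        (e.sum fun i n => n • coverExponent (a + 1) (b + 1) (coverBasisIndex a b i)) =
        (∑ i, e i) * (a + 1 + (b + 1)) := by
    rw [Finsupp.sum_fintype _ _ (by simp), map_sum, Finset.sum_mul]
    exact Finset.sum_congr rfl fun i _ => by rw [map_nsmul, weight_coverExponent, smul_eq_mul]
  -- All generators have the same positive weight, so the total multiplicity is determined. Each
  -- coordinate below is this total minus the multiplicities of the generators omitting that vertex.
  have ht : ∑ i, e i = ∑ i, f i := by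
    refine Nat.eq_of_mul_eq_mul_right (m := a + 1 + (b + 1)) (by omega) ?_
    rw [← hw, ← hw]
    exact congrArg _ h
  simp only [Fintype.sum_option, Fintype.sum_sum_type] at hv ht
  have hz := hv (.inl (Fin.last _))
  simp only [coverBasisIndex, coverExponent_none_inl, coverExponent_some_inl,
    (Fin.castSucc_ne_last _).symm, if_true, if_false, mul_zero, mul_one, zero_add] at hz
  have hnone : e none = f none := by omega
  have hinr (i : Fin a) : e (some (.inr i)) = f (some (.inr i)) := by
    have h1 := hv (.inl i.succ.castSucc)
    have h2 := sum_ite_zero_add (fun i => e (some (.inr i))) i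
    have h3 := sum_ite_zero_add (fun i => f (some (.inr i))) i
    simp only [coverBasisIndex, coverExponent_none_inl, coverExponent_some_inl,
      Fin.castSucc_ne_last, Fin.castSucc_inj, Fin.succ_ne_zero, Fin.succ_inj, if_false, mul_ite,
      mul_zero, mul_one, eq_comm (a := i)] at h1
    omega
  have hinl0 : ∑ i : Fin a, e (some (.inr i)) = ∑ i : Fin a, f (some (.inr i)) :=
    Finset.sum_congr rfl fun i _ => hinr i
  have hinl (j : Fin (b + 1)) : e (some (.inl j)) = f (some (.inl j)) := by
    have h1 := hv (.inr j)
    have h2 := sum_ite_zero_add (fun j => e (some (.inl j))) j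
    have h3 := sum_ite_zero_add (fun j => f (some (.inl j))) j
    simp only [coverBasisIndex, coverExponent_none_inr, coverExponent_some_inr, mul_ite,
      mul_zero, mul_one, eq_comm (a := j)] at h1
    -- Vertex `j = 0` is also omitted by every `u_i0`, whose multiplicities are already known to
    -- agree.
    split_ifs at h1
    · simp only [Finset.sum_const_zero] at h1
      omega
    · omega
  ext (_ | j | i)
  · exact hnone
  · exact hinl j
  · exact hinr i

theorem coverExponent_add_comm (a b : ℕ) (i i' : Fin a) (j j' : Fin b) :
    coverExponent a b (some (i, j)) + coverExponent a b (some (i', j')) =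
      coverExponent a b (some (i', j)) + coverExponent a b (some (i, j')) := by
  rw [← coverSqExponent_inr_mk, ← coverSqExponent_inr_mk, Sym2.eq_swap]

theorem trdeg_eq_card_of_isAlgebraic {k A ι κ : Type*} [Field k] [CommRing A] [IsDomain A]
    [Algebra k A] [Fintype ι] {v : ι → A} (hv : AlgebraicIndependent k v) {U : κ → A}
    (hU : Algebra.adjoin k (Set.range U) = ⊤)
    (halg : ∀ p, IsAlgebraic (Algebra.adjoin k (Set.range v)) (U p)) :
    Algebra.trdeg k A = Fintype.card ι := by
  have hA : Algebra.IsAlgebraic (Algebra.adjoin k (Set.range v)) A := by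
    have hle : Algebra.adjoin k (Set.range U) ≤ (Subalgebra.algebraicClosure
        (Algebra.adjoin k (Set.range v)) A).restrictScalars k :=
      Algebra.adjoin_le (Set.range_subset_iff.2 halg)
    exact ⟨fun x => hle (hU ▸ Algebra.mem_top)⟩
  have hcard := (hv.isTranscendenceBasis_iff_isAlgebraic.2 hA).lift_cardinalMk_eq_trdeg
  rw [← Cardinal.lift_inj, ← hcard, Cardinal.mk_fintype, Cardinal.lift_natCast,
    Cardinal.lift_natCast]

theorem trdeg_adjoin_coverExponent (k : Type*) [Field k] (a b : ℕ) :
    Algebra.trdeg k (Algebra.adjoin k ((fun c => monomial c (1 : k)) ''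
      Set.range (coverExponent (a + 1) (b + 1)))) = (a + b + 2 : ℕ) := by
  set A := Algebra.adjoin k ((fun c => monomial c (1 : k)) ''
      Set.range (coverExponent (a + 1) (b + 1)))
  let U (p : Option (Fin (a + 1) × Fin (b + 1))) : A :=
    ⟨monomial (coverExponent (a + 1) (b + 1) p) 1, Algebra.subset_adjoin ⟨_, ⟨p, rfl⟩, rfl⟩⟩
  have hU0 (p) : U p ≠ 0 := fun h => by
    simpa [U] using congrArg Subtype.val h
  have hmul (i : Fin (a + 1)) (j : Fin (b + 1)) :
      U (some (0, 0)) * U (some (i, j)) = U (some (i, 0)) * U (some (0, j)) :=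
    Subtype.ext (by
      simp only [U, MulMemClass.mk_mul_mk, monomial_mul, mul_one]
      rw [coverExponent_add_comm])
  have hind : AlgebraicIndependent k (U ∘ coverBasisIndex a b) := by
    refine AlgebraicIndependent.of_comp A.val ?_
    exact algebraicIndependent_monomial _ (coverBasis_sum_injective a b)
  have hmem (i) : IsAlgebraic (Algebra.adjoin k (Set.range (U ∘ coverBasisIndex a b)))
      (U (coverBasisIndex a b i)) :=
    isAlgebraic_algebraMap
      (⟨_, Algebra.subset_adjoin ⟨i, rfl⟩⟩ :
        Algebra.adjoin k (Set.range (U ∘ coverBasisIndex a b)))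
  have hcol (i : Fin (a + 1)) : IsAlgebraic
      (Algebra.adjoin k (Set.range (U ∘ coverBasisIndex a b))) (U (some (i, 0))) := by
    induction i using Fin.cases with
    | zero => exact hmem (some (.inl 0))
    | succ i => exact hmem (some (.inr i))
  have halg (p) : IsAlgebraic
      (Algebra.adjoin k (Set.range (U ∘ coverBasisIndex a b))) (U p) := by
    rcases p with _ | ⟨i, j⟩
    · exact hmem none
    -- The relation `u_00 u_ij = u_i0 u_0j` makes `u_ij` algebraic over the basis.
    · refine IsAlgebraic.of_mul (mem_nonZeroDivisors_of_ne_zero (hU0 (some (0, 0)))) (hcol 0) ?_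
      rw [hmul]
      exact (hcol i).mul (hmem (some (.inl j)))
  have hgen : Algebra.adjoin k (Set.range U) = ⊤ := by
    rw [← Algebra.adjoin_adjoin_coe_preimage]
    congr 1
    ext x
    simp [U, Subtype.ext_iff]
  rw [trdeg_eq_card_of_isAlgebraic hind hgen halg]
  simp only [Fintype.card_option, Fintype.card_sum, Fintype.card_fin]
  congr 1
  omega

theorem analyticSpread_coverIdeal (k : Type*) [Field k] (a b : ℕ) :
    analyticSpread (coverIdeal k (sharedVertexGraph (a + 2) (b + 2))) = (a + b + 2 : ℕ) := by
  have h := analyticSpread_monomialIdeal (k := k) (coverWeight_ne_zero (a + 1) (b + 1)) (by omega)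
    (weight_of_mem_range_coverExponent (a + 1) (b + 1))
  rw [coverIdeal_sharedVertexGraph a.succ_ne_zero b.succ_ne_zero]
  refine h.trans ?_
  have : Algebra.FiniteType k (Algebra.adjoin k ((fun c => monomial c (1 : k)) ''
      Set.range (coverExponent (a + 1) (b + 1)))) :=
    (Subalgebra.fg_iff_finiteType _).1 
      (Subalgebra.fg_def.2 ⟨_, (Set.finite_range _).image _, rfl⟩)
  exact ringKrullDim_eq_of_trdeg_eq k (trdeg_adjoin_coverExponent k a b)

/-! ### The Freiman equation. -/

theorem two_mul_cast_choose_two (n : ℕ) : 2 * (n.choose 2 : ℤ) = n * (n - 1) := by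
  induction n with
  | zero => simp
  | succ n ih =>
    rw [Nat.choose_succ_succ' n 1, Nat.choose_one_right]
    push_cast
    linarith

/-- Here `a = n - 2` and `b = m - 2`. Four times the difference of the two sides is `a * (a - 1) *
(b * (b - 1))`; since `a ≤ b`, its vanishing means `a ≤ 1`. -/
theorem freiman_count_iff (a b : ℕ) (hab : a ≤ b) :
    (((a + 1) * (b + 1) + 1 + (a + 2).choose 2 * (b + 2).choose 2 : ℕ) : ℤ) =
      (a + b + 2 : ℕ) * ((a + 1) * (b + 1) + 1 : ℕ) - ((a + b + 2).choose 2 : ℕ) ↔ a ≤ 1 := by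
  have h1 := two_mul_cast_choose_two (a + 2)
  have h2 := two_mul_cast_choose_two (b + 2)
  have h3 := two_mul_cast_choose_two (a + b + 2)
  have h12 : 4 * (((a + 2).choose 2 : ℤ) * (b + 2).choose 2) =
      ((a + 2 : ℕ) * ((a + 2 : ℕ) - 1)) * ((b + 2 : ℕ) * ((b + 2 : ℕ) - 1)) := by
    rw [← h1, ← h2]
    ring
  push_cast at h3 h12 ⊢
  have key : (a : ℤ) * (a - 1) * (b * (b - 1)) = 0 ↔ a ≤ 1 := by
    simp only [mul_eq_zero, sub_eq_zero]
    norm_cast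
    omega
  rw [← key]
  constructor <;> intro h <;> linarith

end SharedVertexGraph

theorem mainTheorem5 (k : Type*) [Field k] (n m : ℕ) (hn : 2 ≤ n) (hnm : n ≤ m) :
    IsQuasiEquigenerated (coverIdeal k (sharedVertexGraph n m)) ∧
      analyticSpread (coverIdeal k (sharedVertexGraph n m)) = ((n + m - 2 : ℕ) : WithBot ℕ∞) ∧
      (IsFreiman (coverIdeal k (sharedVertexGraph n m)) ↔ n ≤ 3) := by
  obtain ⟨a, rfl⟩ := Nat.exists_eq_add_of_le' hn
  obtain ⟨b, rfl⟩ := Nat.exists_eq_add_of_le' (hn.trans hnm)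
  have hquasi : IsQuasiEquigenerated (coverIdeal k (sharedVertexGraph (a + 2) (b + 2))) := by
    rw [coverIdeal_sharedVertexGraph a.succ_ne_zero b.succ_ne_zero]
    exact isQuasiEquigenerated_monomialIdeal (coverWeight_ne_zero (a + 1) (b + 1))
      (weight_of_mem_range_coverExponent (a + 1) (b + 1))
  have hspread := analyticSpread_coverIdeal k a b
  refine ⟨hquasi, ?_, ?_⟩
  · rw [hspread, show a + 2 + (b + 2) - 2 = a + b + 2 by omega]
  · have hmu := minGenerators_coverIdeal (k := k) a.succ_ne_zero b.succ_ne_zero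
    have hmu2 := minGenerators_coverIdeal_sq (k := k) a.succ_ne_zero b.succ_ne_zero
    have hcount := freiman_count_iff a b (by omega)
    rw [show a + 2 ≤ 3 ↔ a ≤ 1 by omega, ← hcount]
    constructor
    · rintro ⟨-, l, hl, h⟩
      rw [hspread] at hl
      obtain rfl : a + b + 2 = l := by exact_mod_cast hl
      rwa [hmu, hmu2] at h
    · intro h
      refine ⟨hquasi, a + b + 2, hspread, ?_⟩
      rwa [hmu, hmu2]
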